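/- Let $H$ be a complex Hilbert space, let $\mathcal R\subseteq B(H)$ be an injective von Neumann algebra (every completely positive map into $\mathcal R$ from a unital C*-subalgebra $A$ of a unital C*-algebra $B$, with the same unit, extends to a completely positive map $B\to\mathcal R$), and let $G$ be a discrete group acting on $\mathcal R$ by *-automorphisms $\alpha_g$, $g\in G$. Let $(\delta_g)_{g\in G}$ be the canonical basis of $\ell_2(G)$, $\lambda_g\delta_h=\delta_{gh}$ the left translations and $e_{(g,h)}$ the matrix units of $B(\ell_2(G))$. Write $x=\sum_{g,h}x_{(g,h)}\otimes e_{(g,h)}$, $x_{(g,h)}\in B(H)$, for the block matrix of $x\in B(H\otimes\ell_2(G))$. Put $L_g:=I_H\otimes\lambda_g$ and $\Psi(r):=\sum_{g\in G}\alpha_{g^{-1}}(r)\otimes e_{(g,g)}$ for $r\in\mathcal R$, and let the crossed product $\mathcal L(\mathcal R,\alpha,G)$ be the ultraweak closure of $\operatorname{span}\{L_g\Psi(r): g\in G,\ r\in\mathcal R\}$ in $B(H\otimes\ell_2(G))$. Then there is a completely positive conditional expectation of $B(H)$ onto $\mathcal R$, i.e. a completely positive map $B(H)\to\mathcal R$ that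 is the identity on $\mathcal R$. Moreover, for every such $\pi$ and every unit vector $\xi=(k_g)_{g\in G}\in\ell_2(G)$ the following holds. For every $x\in B(H\otimes\ell_2(G))$ there is exactly one bounded operator $\sigma_\xi(x)$ on $H\otimes\ell_2(G)$ with $$\sigma_\xi(x)=\sum_{g,h\in G}L_{gh^{-1}}\Psi\big(\alpha_h(\pi(x_{(g,h)}))\big)\,\overline{k_g}\,k_h ,$$ where the sum is taken block by block: for all $s,t\in G$ the $(s,t)$-blocks of the terms are unconditionally summable in the norm of $B(H)$, and their sum is the $(s,t)$-block of $\sigma_\xi(x)$. The map $\sigma_\xi$ so defined 1. is linear and completely positive, with values in $\mathcal L(\mathcal R,\alpha,G)$; 2. is unital: $\sigma_\xi(I)=I$; 3. is $\Psi(\mathcal R)$-bimodular: $\sigma_\xi(\Psi(r)x\Psi(r'))=\Psi(r)\sigma_\xi(x)\Psi(r')$ for all $r,r'\in\mathcal R$ and $x\in B(H\otimes\ell_2(G))$; 4. satisfies $\sigma_\xi(L_g\Psi(r))=\langle\lambda_g\xi,\xi\rangle\,L_g\Psi(r)$ for all $g\in G$ and $r\in\mathcal R$, where $\langle\cdot,\cdot\rangle$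 is linear in its first argument. -/

import Mathlib

open scoped CStarAlgebra ENNReal

noncomputable section

namespace CrossedExp

universe u v

/-! ### Block operators on `ℓ₂(G, E)`, the standard model of `E ⊗ ℓ₂(G)` -/

/-- The Hilbert space `E ⊗ ℓ₂(G)`, realised as the Hilbert direct sum of copies of `E` indexed by
`G`: the vector `e ⊗ δ_g` is the family with value `e` at `g` and `0` elsewhere.
For `E = ℂ` this is `ℓ₂(G)` itself. -/
abbrev L2 (G : Type v) (E : Type u) [NormedAddCommGroup E] : Type (max u v) :=
  lp (fun _ : G => E) 2

section Translation

variable {G : Type v} [Group G] (E : Type u) [NormedAddCommGroup E]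

theorem memlp_translate (g : G) (f : L2 G E) :
    Memℓp (fun s => (f : ∀ _ : G, E) (g⁻¹ * s)) 2 := by
  apply memℓp_gen
  exact ((lp.memℓp f).summable (by norm_num)).comp_injective (mul_right_injective g⁻¹)

theorem norm_translate (g : G) (f : L2 G E) :
    ‖(⟨_, memlp_translate E g f⟩ : L2 G E)‖ = ‖f‖ := by
  rw [lp.norm_eq_tsum_rpow (by norm_num), lp.norm_eq_tsum_rpow (by norm_num)]
  congr 1
  exact (Equiv.mulLeft g⁻¹).tsum_eq (fun s => ‖(f : ∀ _ : G, E) s‖ ^ (2 : ℝ≥0∞).toReal)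

variable [InnerProductSpace ℂ E]

/-- The left translation `I ⊗ λ_g` on `E ⊗ ℓ₂(G)`: it maps `e ⊗ δ_h` to `e ⊗ δ_{gh}`. -/
def leftTranslation (g : G) : L2 G E →L[ℂ] L2 G E :=
  LinearMap.mkContinuous
    { toFun := fun f => ⟨_, memlp_translate E g f⟩
      map_add' := fun _ _ => rfl
      map_smul' := fun _ _ => rfl } 1
    (fun f => by rw [one_mul]; exact (norm_translate E g f).le)

end Translation

section Blocks

variable {H : Type u} [NormedAddCommGroup H] [InnerProductSpace ℂ H] {G : Type v}

open Classical in
/-- The block `x_{(g,h)}` of `x = ∑ x_{(g,h)} ⊗ e_{(g,h)}`: the operator that takes `η` to the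
`g`-th component of `x (η ⊗ δ_h)`. -/
def block (x : L2 G H →L[ℂ] L2 G H) (g h : G) : H →L[ℂ] H :=
  (lp.evalCLM ℂ (fun _ : G => H) 2 g) ∘L x ∘L
    (lp.singleContinuousLinearMap ℂ (fun _ : G => H) 2 h)

/-- The family of operators `f i` sums to the bounded operator `y` block by block: for all `s, t`
the blocks `(f i)_{(s,t)}` are unconditionally summable in norm with sum `y_{(s,t)}`. -/
def HasBlockSum {ι : Type*} (f : ι → (L2 G H →L[ℂ] L2 G H)) (y : L2 G H →L[ℂ] L2 G H) : Prop :=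
  ∀ s t : G, HasSum (fun i => block (f i) s t) (block y s t)

theorem memlp_diag (d : G → (H →L[ℂ] H)) (C : ℝ) (hd : ∀ g, ‖d g‖ ≤ C) (f : L2 G H) :
    Memℓp (fun s => d s ((f : ∀ _ : G, H) s)) 2 := by
  apply memℓp_gen
  have h := ((lp.memℓp f).summable (by norm_num : 0 < (2 : ℝ≥0∞).toReal)).mul_left
    (C ^ (2 : ℝ≥0∞).toReal)
  refine Summable.of_nonneg_of_le (fun _ => by positivity) (fun s => ?_) h
  have hC : 0 ≤ C := (norm_nonneg _).trans (hd s)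
  rw [← Real.mul_rpow hC (norm_nonneg _)]
  exact Real.rpow_le_rpow (norm_nonneg _) ((d s).le_of_opNorm_le (hd s) _) (by norm_num)

theorem norm_diag_le (d : G → (H →L[ℂ] H)) (C : ℝ) (hC : 0 ≤ C) (hd : ∀ g, ‖d g‖ ≤ C)
    (f : L2 G H) : ‖(⟨_, memlp_diag d C hd f⟩ : L2 G H)‖ ≤ C * ‖f‖ := by
  have h2 : 0 < (2 : ℝ≥0∞).toReal := by norm_num
  refine lp.norm_le_of_forall_sum_le h2 (by positivity) (fun s => ?_)
  rw [Real.mul_rpow hC (norm_nonneg _)]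
  calc ∑ i ∈ s, ‖d i ((f : ∀ _ : G, H) i)‖ ^ (2 : ℝ≥0∞).toReal
      ≤ ∑ i ∈ s, C ^ (2 : ℝ≥0∞).toReal * ‖(f : ∀ _ : G, H) i‖ ^ (2 : ℝ≥0∞).toReal := by
        refine Finset.sum_le_sum (fun i _ => ?_)
        rw [← Real.mul_rpow hC (norm_nonneg _)]
        exact Real.rpow_le_rpow (norm_nonneg _) ((d i).le_of_opNorm_le (hd i) _) h2.le
    _ = C ^ (2 : ℝ≥0∞).toReal * ∑ i ∈ s, ‖(f : ∀ _ : G, H) i‖ ^ (2 : ℝ≥0∞).toReal := by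
        rw [Finset.mul_sum]
    _ ≤ _ := by
        gcongr
        exact lp.sum_rpow_le_norm_rpow h2 f s

/-- The block diagonal operator `∑_g d_g ⊗ e_{(g,g)}` of a bounded family. -/
def blockDiagonal (d : G → (H →L[ℂ] H)) (C : ℝ) (hC : 0 ≤ C) (hd : ∀ g, ‖d g‖ ≤ C) :
    L2 G H →L[ℂ] L2 G H :=
  LinearMap.mkContinuous
    { toFun := fun f => ⟨_, memlp_diag d C hd f⟩
      map_add' := fun f f' => by ext s; exact map_add (d s) _ _
      map_smul' := fun c f => by ext s; exact map_smul (d s) c _ } C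
    (norm_diag_le d C hC hd)

end Blocks

/-! ### Injectivity, conditional expectations and the ultraweak topology -/

section VonNeumann

variable {H : Type u} [NormedAddCommGroup H] [InnerProductSpace ℂ H] [CompleteSpace H]

/-- The von Neumann algebra `R` is injective: for every unital inclusion `A ⊆ B` of unital
C*-algebras, each completely positive map `A → R` extends to a completely positive map `B → R`.
(A matrix over `R` is positive over `R` if and only if it is positive over `B(H)`, so a completely
positive map into `R` is one into `B(H)` whose values lie in `R`.) -/
def IsInjective (R : VonNeumannAlgebra H) : Prop :=
  ∀ (A B : Type u) [CStarAlgebra A] [PartialOrder A] [StarOrderedRing A]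
    [CStarAlgebra B] [PartialOrder B] [StarOrderedRing B]
    (ι : A →⋆ₐ[ℂ] B) (_ : Function.Injective ι)
    (φ : A →CP (H →L[ℂ] H)) (_ : ∀ a, φ a ∈ R),
    ∃ ψ : B →CP (H →L[ℂ] H), (∀ b, ψ b ∈ R) ∧ ∀ a, ψ (ι a) = φ a

/-- A completely positive conditional expectation of `B(H)` onto `R`: a completely positive map
with values in `R` that is the identity on `R`. -/
structure CondExpectation (R : VonNeumannAlgebra H) where
  toCP : (H →L[ℂ] H) →CP (H →L[ℂ] H)
  mem : ∀ x, toCP x ∈ R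
  fix : ∀ r ∈ R, toCP r = r

/-- A conditional expectation, as a map with values in `R`. -/
def CondExpectation.val {R : VonNeumannAlgebra H} (π : CondExpectation R) (x : H →L[ℂ] H) :
    R.toStarSubalgebra :=
  ⟨π.toCP x, π.mem x⟩

/-- The ultraweak topology of `B(H)`: the coarsest one for which all the functionals
`x ↦ ∑ₙ ⟨x ηₙ, ζₙ⟩` with `∑ₙ ‖ηₙ‖² < ∞` and `∑ₙ ‖ζₙ‖² < ∞` are continuous. -/
@[reducible]
def ultraweakTopology (H : Type u) [NormedAddCommGroup H] [InnerProductSpace ℂ H] :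
    TopologicalSpace (H →L[ℂ] H) :=
  TopologicalSpace.induced
    (fun (x : H →L[ℂ] H) (p : L2 ℕ H × L2 ℕ H) =>
      ∑' n, inner ℂ ((p.2 : ∀ _ : ℕ, H) n) (x ((p.1 : ∀ _ : ℕ, H) n)))
    Pi.topologicalSpace

theorem isClosed_vonNeumann (R : VonNeumannAlgebra H) :
    IsClosed (R.toStarSubalgebra : Set (H →L[ℂ] H)) := by
  rw [VonNeumannAlgebra.coe_toStarSubalgebra, ← R.centralizer_centralizer]
  exact Set.isClosed_centralizer _

theorem norm_automorphism_le (R : VonNeumannAlgebra H)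
    (a : R.toStarSubalgebra ≃⋆ₐ[ℂ] R.toStarSubalgebra) (r : R.toStarSubalgebra) :
    ‖(a r : H →L[ℂ] H)‖ ≤ ‖(r : H →L[ℂ] H)‖ := by
  let _ : CStarAlgebra R.toStarSubalgebra :=
    StarSubalgebra.cstarAlgebra _ (h_closed := isClosed_vonNeumann R)
  exact NonUnitalStarAlgHom.norm_apply_le a r

end VonNeumann

/-! ### The crossed product and the map `σ_ξ` -/

section CrossedProduct

variable {H : Type u} [NormedAddCommGroup H] [InnerProductSpace ℂ H] [CompleteSpace H]
  {G : Type v} [Group G] (R : VonNeumannAlgebra H)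
  (α : G →* (R.toStarSubalgebra ≃⋆ₐ[ℂ] R.toStarSubalgebra))

/-- The representation `Ψ(r) = ∑_g α_{g⁻¹}(r) ⊗ e_{(g,g)}` of `R` on `H ⊗ ℓ₂(G)`. -/
def Psi (r : R.toStarSubalgebra) : L2 G H →L[ℂ] L2 G H :=
  blockDiagonal (fun g => (α g⁻¹ r : H →L[ℂ] H)) ‖(r : H →L[ℂ] H)‖ (norm_nonneg _)
    (fun g => norm_automorphism_le R (α g⁻¹) r)

/-- The crossed product von Neumann algebra `L(R, α, G)`: the ultraweak closure of the linear span
of the operators `L_g Ψ(r)`. -/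
def crossedProduct : Set (L2 G H →L[ℂ] L2 G H) :=
  @closure _ (ultraweakTopology (L2 G H))
    (Submodule.span ℂ {y : L2 G H →L[ℂ] L2 G H |
      ∃ (g : G) (r : R.toStarSubalgebra), y = leftTranslation H g * Psi R α r} :
      Set (L2 G H →L[ℂ] L2 G H))

/-- The `(g,h)`-term `L_{gh⁻¹} Ψ(α_h(π(x_{(g,h)}))) \overline{k_g} k_h` of the series that defines
`σ_ξ(x)`, for `ξ = (k_g)`. -/
def sigmaTerm (π : CondExpectation R) (ξ : L2 G ℂ) (x : L2 G H →L[ℂ] L2 G H) (p : G × G) :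
    L2 G H →L[ℂ] L2 G H :=
  (star ((ξ : G → ℂ) p.1) * (ξ : G → ℂ) p.2) •
    (leftTranslation H (p.1 * p.2⁻¹) * Psi R α (α p.2 (π.val (block x p.1 p.2))))

end CrossedProduct

end CrossedExp

end

/-!
Write `K = H ⊗ ℓ₂(G)` and `θ = Ψ ∘ π : B(H) → B(K)`. By covariance,
`L_{gh⁻¹} Ψ(α_h(r)) = L_g Ψ(r) L_h*`, so the series is
`σ_ξ(x) = ∑_{g,h} (k_g L_g*)* θ(x_{(g,h)}) (k_h L_h*)`: the map `θ` is applied to every block of `x`,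
and the result is compressed by the column `(k_h L_h*)_h`, an isometry when `‖ξ‖ = 1`. This is
completely positive as soon as `θ` is.

Complete positivity is handled through quadratic forms: a matrix over `B(E)` is positive in the
C*-algebra `M_n(B(E))` if and only if its quadratic form is nonnegative
(`cstarMatrix_nonneg_iff`), because `M_n(B(E))` acts faithfully on `Eⁿ` and injective
`*`-homomorphisms reflect positivity (`nonneg_of_map_nonneg`). The same reflection principle, applied
to `M_n(R) ⊆ M_n(B(H))`, makes `θ` completely positive although `Ψ` is defined on `R` only
(`PosMatrix.map_Psi_condExpectation`).

The sum of the terms over a rectangle `A × B` of indices is treated in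
`sum_inner_partialSigma_nonneg`, where the rectangle may vary with the entry of an operator matrix.
Applied to the positive matrix with diagonal entries `‖x‖` and off-diagonal entries `x`, `x*`, this
bounds the norm of the sum by `‖x‖ ‖ξ|_A‖ ‖ξ|_B‖` (`norm_partialSigma_le`). Hence the sums over
finite squares `F × F` converge in norm (`cauchySeq_partialSigma`). Their limit `σ_ξ(x)` inherits
complete positivity, and it lies in the norm closure of the span of the operators `L_g Ψ(r)`, which
is contained in the ultraweak closure. The estimate for single terms, with the Cauchy–Schwarz
inequality, makes the series of every block absolutely summable, and its sum is the block of the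
limit (`hasBlockSum_iff`).

The bimodule property holds term by term; it rests on `π(r x r') = r π(x) r'`, that is, on the fact
that `R` lies in the multiplicative domain of `π` (`CondExpectation.inner_mul`). In the series for
`L_g Ψ(r)` only the indices `(gq, q)` occur, and the coefficients add up to `⟨λ_g ξ, ξ⟩`. The case
`g = 1`, `r = 1` is unitality.
-/

open scoped ComplexOrder

open Filter Topology

noncomputable section

namespace CrossedExp

universe u v

/-! ### Positive operator matrices -/

section Reflect

variable {A B : Type*} [NonUnitalCStarAlgebra A] [PartialOrder A] [StarOrderedRing A]
  [NonUnitalCStarAlgebra B] [PartialOrder B] [StarOrderedRing B]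

/-- An injective `*`-homomorphism commutes with taking negative parts, so it reflects
positivity. -/
theorem nonneg_of_map_nonneg (φ : A →⋆ₙₐ[ℂ] B) (hφ : Function.Injective φ) {a : A}
    (ha : 0 ≤ φ a) : 0 ≤ a := by
  have hsa : IsSelfAdjoint a := hφ (by rw [map_star, (IsSelfAdjoint.of_nonneg ha).star_eq])
  have hcont : Continuous φ := map_continuous φ
  rw [← CFC.negPart_eq_zero_iff a hsa]
  apply hφ
  rw [map_zero, CFC.negPart_def,
    NonUnitalStarAlgHom.map_cfcₙ (R := ℝ) φ _ a (hφ := hcont) (hφa := IsSelfAdjoint.of_nonneg ha),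
    ← CFC.negPart_def]
  exact (CFC.negPart_eq_zero_iff _ (IsSelfAdjoint.of_nonneg ha)).2 ha

end Reflect

section PosMatrix

variable {E : Type u} [NormedAddCommGroup E] [InnerProductSpace ℂ E]

/-- A square matrix of operators on `E` is positive if its quadratic form on families of vectors
of `E` is nonnegative. -/
def PosMatrix {n : Type*} [Fintype n] (M : n → n → (E →L[ℂ] E)) : Prop :=
  ∀ v : n → E, 0 ≤ ∑ i, ∑ j, inner ℂ (v i) (M i j (v j))

variable [CompleteSpace E] {n : Type*} [Fintype n]

variable (E n) in
/-- The representation of `M_n(B(E))` on the Hilbert space direct sum of `n` copies of `E`. -/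
def amplify : CStarMatrix n n (E →L[ℂ] E) →⋆ₙₐ[ℂ]
    (PiLp 2 (fun _ : n => E) →L[ℂ] PiLp 2 (fun _ : n => E)) where
  toFun M := (PiLp.continuousLinearEquiv 2 ℂ (fun _ : n => E)).symm.toContinuousLinearMap ∘L
    ContinuousLinearMap.pi fun i => ∑ j, M i j ∘L PiLp.proj 2 (fun _ : n => E) j
  map_smul' c M := by
    ext v i
    simp [Finset.smul_sum]
  map_zero' := by
    ext v i
    simp
  map_add' M N := by
    ext v i
    simp [Finset.sum_add_distrib]
  map_mul' M N := by
    ext v i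
    simp only [CStarMatrix.mul_apply]
    simp only [ContinuousLinearMap.coe_comp, ContinuousLinearEquiv.coe_coe,
      Function.comp_apply, PiLp.continuousLinearEquiv_symm_apply, ContinuousLinearMap.coe_pi',
      _root_.sum_apply, PiLp.proj_apply, _root_.mul_apply_eq_comp, map_sum]
    exact Finset.sum_comm
  map_star' M := by
    rw [ContinuousLinearMap.star_eq_adjoint, ContinuousLinearMap.eq_adjoint_iff]
    intro v w
    simp only [PiLp.inner_apply, ContinuousLinearMap.coe_comp, ContinuousLinearEquiv.coe_coe,
      Function.comp_apply, PiLp.continuousLinearEquiv_symm_apply, ContinuousLinearMap.coe_pi',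
      _root_.sum_apply, PiLp.proj_apply, sum_inner, inner_sum, CStarMatrix.star_apply,
      ContinuousLinearMap.star_eq_adjoint, ContinuousLinearMap.adjoint_inner_left]
    exact Finset.sum_comm

theorem amplify_apply (M : CStarMatrix n n (E →L[ℂ] E)) (v : PiLp 2 (fun _ : n => E)) (i : n) :
    amplify E n M v i = ∑ j, M i j (v j) := by
  simp [amplify]

theorem inner_amplify (M : CStarMatrix n n (E →L[ℂ] E)) (v : PiLp 2 (fun _ : n => E)) :
    inner ℂ v (amplify E n M v) = ∑ i, ∑ j, inner ℂ (v i) (M i j (v j)) := by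
  simp [PiLp.inner_apply, amplify_apply, inner_sum]

theorem amplify_injective : Function.Injective (amplify E n) := by
  classical
  refine (injective_iff_map_eq_zero _).2 fun M hM => ?_
  ext i j x
  have := congrArg (fun T => (T (WithLp.toLp 2 (Pi.single j x))) i) hM
  simp only [amplify_apply] at this
  rw [Finset.sum_eq_single j] at this
  · simpa using this
  · intro b _ hb
    simp [Pi.single_eq_of_ne hb]
  · simp

/-- The abstract order of the C*-algebra `M_n(B(E))` is the one given by quadratic forms. -/
theorem cstarMatrix_nonneg_iff (M : CStarMatrix n n (E →L[ℂ] E)) :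
    0 ≤ M ↔ PosMatrix fun i j => M i j := by
  constructor
  · intro hM v
    have h : 0 ≤ amplify E n M := map_nonneg (amplify E n) hM
    rw [ContinuousLinearMap.nonneg_iff_isPositive] at h
    have := h.inner_nonneg_right (WithLp.toLp 2 v)
    rwa [inner_amplify] at this
  · intro hM
    refine nonneg_of_map_nonneg (amplify E n) amplify_injective ?_
    rw [ContinuousLinearMap.nonneg_iff_isPositive,
      ContinuousLinearMap.isPositive_iff_complex]
    intro v
    have h : 0 ≤ inner ℂ (amplify E n M v) v := by
      rw [← inner_conj_symm, inner_amplify]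
      exact star_nonneg_iff.2 (hM v)
    rw [Complex.nonneg_iff] at h
    exact ⟨Complex.ext rfl h.2, h.1⟩

variable {K : Type v} [NormedAddCommGroup K] [InnerProductSpace ℂ K] [CompleteSpace K]

theorem PosMatrix.map_cp (φ : (E →L[ℂ] E) →CP (K →L[ℂ] K)) {M : n → n → (E →L[ℂ] E)}
    (hM : PosMatrix M) : PosMatrix fun i j => φ (M i j) := by
  have h : 0 ≤ CStarMatrix.ofMatrix (Matrix.of M) := (cstarMatrix_nonneg_iff _).2 hM
  exact (cstarMatrix_nonneg_iff _).1 (φ.map_cstarMatrix_nonneg _ h)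

/-- The inclusion of matrices over `R` into matrices over `B(E)` reflects positivity, so a
`*`-homomorphism defined only on `R` preserves positivity of operator matrices over `R`. -/
theorem PosMatrix.map_starHom (R : VonNeumannAlgebra E)
    (ρ : R.toStarSubalgebra →⋆ₐ[ℂ] (K →L[ℂ] K)) {M : n → n → R.toStarSubalgebra}
    (hM : PosMatrix fun i j => (M i j : E →L[ℂ] E)) : PosMatrix fun i j => ρ (M i j) := by
  let _ : CStarAlgebra R.toStarSubalgebra :=
    StarSubalgebra.cstarAlgebra _ (h_closed := isClosed_vonNeumann R)
  let _ : PartialOrder R.toStarSubalgebra := CStarAlgebra.spectralOrder _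
  have _ : StarOrderedRing R.toStarSubalgebra := CStarAlgebra.spectralOrderedRing _
  let inc : R.toStarSubalgebra →⋆ₙₐ[ℂ] (E →L[ℂ] E) :=
    (R.toStarSubalgebra.subtype : R.toStarSubalgebra →⋆ₐ[ℂ] (E →L[ℂ] E)).toNonUnitalStarAlgHom
  let ρ' : R.toStarSubalgebra →⋆ₙₐ[ℂ] (K →L[ℂ] K) := ρ.toNonUnitalStarAlgHom
  let N : CStarMatrix n n R.toStarSubalgebra := CStarMatrix.ofMatrix (Matrix.of M)
  have hinj : Function.Injective (CStarMatrix.mapₙₐ (n := n) inc) := by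
    intro X Y h
    ext i j : 2
    exact congrFun (congrFun h i) j
  have hN : 0 ≤ N := by
    refine nonneg_of_map_nonneg _ hinj ?_
    rw [cstarMatrix_nonneg_iff]
    exact hM
  have h2 : 0 ≤ CStarMatrix.mapₙₐ (n := n) ρ' N := map_nonneg _ hN
  exact (cstarMatrix_nonneg_iff _).1 h2

end PosMatrix

/-! ### Positive `2 × 2` forms and the multiplicative domain -/

/-- The determinant inequality for a positive `2 × 2` matrix, from its values at the vectors
`(a, 1)`. -/
theorem det_nonneg_of_form_nonneg {P Q z z' : ℂ}
    (h : ∀ a : ℂ, 0 ≤ star a * a * P + Q + star a * z + a * z') (hP : P.im = 0) (hQ : Q.im = 0) :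
    z' = star z ∧ ‖z‖ ^ 2 ≤ P.re * Q.re := by
  have h1 := (Complex.nonneg_iff.1 (h 1)).2
  have hI := (Complex.nonneg_iff.1 (h Complex.I)).2
  simp [hP, hQ] at h1 hI
  have hz : z' = star z := by
    apply Complex.ext <;> simp <;> linarith
  refine ⟨hz, ?_⟩
  have hsq : ‖z‖ ^ 2 = z.re * z.re + z.im * z.im := by
    rw [Complex.sq_norm, Complex.normSq_apply]
  have key : ∀ t : ℝ, 0 ≤ (‖z‖ ^ 2 * P.re) * (t * t) + (-2 * ‖z‖ ^ 2) * t + Q.re := by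
    intro t
    -- the value at `a = -t z` is a real quadratic polynomial in `t`
    have := (Complex.nonneg_iff.1 (h (-(t : ℂ) * z))).1
    rw [hz] at this
    simp [hP] at this
    rw [hsq]
    linarith
  have hd := discrim_le_zero key
  rw [discrim] at hd
  rcases (sq_nonneg ‖z‖).eq_or_lt with h0 | h0
  · rw [← h0]
    have hP0 : ∀ t : ℝ, 0 ≤ P.re * (t * t) + 0 * t + Q.re := by
      intro t
      have hz0 : z = 0 := by simpa using h0.symm
      have := (Complex.nonneg_iff.1 (h (t : ℂ))).1
      rw [hz, hz0] at this
      simp [hP] at this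
      linarith
    have := discrim_le_zero hP0
    rw [discrim] at this
    linarith
  · nlinarith

section Multiplicative

variable {H : Type u} [NormedAddCommGroup H] [InnerProductSpace ℂ H] [CompleteSpace H]

theorem posMatrix_star_mul {n : Type*} [Fintype n] (a : n → (H →L[ℂ] H)) :
    PosMatrix fun i j => star (a i) * a j := by
  intro v
  have : ∑ i, ∑ j, inner ℂ (v i) ((star (a i) * a j) (v j)) =
      inner ℂ (∑ i, a i (v i)) (∑ i, a i (v i)) := by
    simp only [sum_inner, inner_sum, mul_apply_eq_comp, ContinuousLinearMap.star_eq_adjoint,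
      ContinuousLinearMap.adjoint_inner_right]
    exact Finset.sum_comm
  rw [this, inner_self_eq_norm_sq_to_K]
  positivity

variable {R : VonNeumannAlgebra H} (π : CondExpectation R)

/-- The matrix `[aᵢ* aⱼ]` for `a = (1, r, x*)` stays positive under `π`, and its form vanishes at
`(-r v, v, 0)`; hence it vanishes on all pairs with one such vector, which is the bimodule
property. -/
theorem CondExpectation.inner_mul (r x : H →L[ℂ] H) (hr : r ∈ R) (v w : H) :
    inner ℂ v ((π.toCP (star r * star x) - star r * π.toCP (star x)) w) = 0 ∧
    inner ℂ w ((π.toCP (x * r) - π.toCP x * r) v) = 0 := by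
  have h1 : π.toCP 1 = 1 := π.fix 1 (one_mem R)
  have hsr : star r ∈ R := star_mem hr
  have hform := (posMatrix_star_mul ![1, r, star x]).map_cp π.toCP
  have key := det_nonneg_of_form_nonneg (P := inner ℂ w (π.toCP (x * star x) w)) (Q := 0)
    (z := inner ℂ w ((π.toCP (x * r) - π.toCP x * r) v))
    (z' := inner ℂ v ((π.toCP (star r * star x) - star r * π.toCP (star x)) w)) ?_ ?_ rfl
  · obtain ⟨h2, h3⟩ := key
    have h4 : inner ℂ w ((π.toCP (x * r) - π.toCP x * r) v) = 0 := by
      have : ‖inner ℂ w ((π.toCP (x * r) - π.toCP x * r) v)‖ ^ 2 ≤ 0 := by simpa using h3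
      simpa using this
    exact ⟨by rw [h2, h4, star_zero], h4⟩
  · intro a
    have := hform ![-(r v), v, a • w]
    simp only [Fin.sum_univ_three, Matrix.cons_val_zero, Matrix.cons_val_one, Matrix.cons_val_two,
      Matrix.head_cons, Matrix.tail_cons, star_one, one_mul, mul_one, star_star,
      h1, π.fix r hr, π.fix _ hsr, π.fix _ (mul_mem hsr hr)] at this
    convert this using 1
    simp only [_root_.sub_apply, mul_apply_eq_comp, inner_sub_right, inner_neg_left,
      inner_neg_right, map_neg, map_smul, inner_smul_left, inner_smul_right, one_apply_eq_self,
      ContinuousLinearMap.star_eq_adjoint, ContinuousLinearMap.adjoint_inner_right]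
    simp only [RCLike.star_def]
    ring
  · have := (posMatrix_star_mul ![star x]).map_cp π.toCP ![w]
    simpa using (Complex.nonneg_iff.1 this).2.symm

theorem CondExpectation.map_mul_right (r x : H →L[ℂ] H) (hr : r ∈ R) :
    π.toCP (x * r) = π.toCP x * r := by
  rw [← sub_eq_zero]
  ext v
  exact inner_self_eq_zero (𝕜 := ℂ).1 (π.inner_mul r x hr v _).2

theorem CondExpectation.map_mul_left (r x : H →L[ℂ] H) (hr : r ∈ R) :
    π.toCP (r * x) = r * π.toCP x := by
  rw [← sub_eq_zero]
  ext v
  have := (π.inner_mul (star r) (star x) (star_mem hr)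
    ((π.toCP (r * x) - r * π.toCP x) v) v).1
  rw [star_star, star_star] at this
  exact inner_self_eq_zero (𝕜 := ℂ).1 this

end Multiplicative

/-! ### Translations, the representation `Ψ` and blocks -/

section Translation

variable {G : Type v} [Group G] {E : Type u} [NormedAddCommGroup E] [InnerProductSpace ℂ E]

theorem leftTranslation_apply (g : G) (f : L2 G E) (s : G) :
    leftTranslation E g f s = f (g⁻¹ * s) := rfl

theorem leftTranslation_mul (g h : G) :
    leftTranslation E (g * h) = leftTranslation E g * leftTranslation E h := by
  ext f s
  simp only [mul_apply_eq_comp, leftTranslation_apply, mul_inv_rev, mul_assoc]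

theorem leftTranslation_one : leftTranslation E (1 : G) = 1 := by
  ext f s
  simp [leftTranslation_apply]

theorem inner_leftTranslation (g : G) (f f' : L2 G E) :
    inner ℂ f (leftTranslation E g f') = inner ℂ (leftTranslation E g⁻¹ f) f' := by
  rw [lp.inner_eq_tsum, lp.inner_eq_tsum, ← (Equiv.mulLeft g).tsum_eq]
  simp [leftTranslation_apply]

end Translation

section Psi

variable {H : Type u} [NormedAddCommGroup H] [InnerProductSpace ℂ H] [CompleteSpace H]
  {G : Type v} [Group G] (R : VonNeumannAlgebra H)
  (α : G →* (R.toStarSubalgebra ≃⋆ₐ[ℂ] R.toStarSubalgebra))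

theorem Psi_apply (r : R.toStarSubalgebra) (f : L2 G H) (s : G) :
    Psi R α r f s = (α s⁻¹ r : H →L[ℂ] H) (f s) := rfl

/-- `Ψ` as a unital `*`-homomorphism. -/
def psiHom : R.toStarSubalgebra →⋆ₐ[ℂ] (L2 G H →L[ℂ] L2 G H) where
  toFun := Psi R α
  map_one' := by
    ext f s
    simp [Psi_apply]
  map_mul' r r' := by
    ext f s
    simp [Psi_apply]
  map_zero' := by
    ext f s
    simp [Psi_apply]
  map_add' r r' := by
    ext f s
    simp [Psi_apply]
  commutes' c := by
    ext f s
    rw [Psi_apply, AlgHomClass.commutes]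
    simp [Algebra.algebraMap_eq_smul_one]
  map_star' r := by
    rw [ContinuousLinearMap.star_eq_adjoint, ContinuousLinearMap.eq_adjoint_iff]
    intro f f'
    rw [lp.inner_eq_tsum, lp.inner_eq_tsum]
    congr 1
    ext s
    rw [Psi_apply, Psi_apply, map_star, StarMemClass.coe_star,
      ContinuousLinearMap.star_eq_adjoint, ContinuousLinearMap.adjoint_inner_left]

theorem psiHom_apply (r : R.toStarSubalgebra) : psiHom R α r = Psi R α r := rfl

/-- Covariance of the pair `(L, Ψ)`. -/
theorem leftTranslation_mul_Psi (g : G) (r : R.toStarSubalgebra) :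
    leftTranslation H g * Psi R α r = Psi R α (α g r) * leftTranslation H g := by
  ext f s
  simp only [mul_apply_eq_comp, leftTranslation_apply, Psi_apply]
  have h : α s⁻¹ (α g r) = α (g⁻¹ * s)⁻¹ r := by
    rw [mul_inv_rev, inv_inv, map_mul]
    rfl
  rw [h]

end Psi

section Block

variable {H : Type u} [NormedAddCommGroup H] [InnerProductSpace ℂ H] {G : Type v}

open Classical in
theorem block_apply (x : L2 G H →L[ℂ] L2 G H) (g h : G) (η : H) :
    block x g h η = x (lp.single 2 h η) g := rfl

theorem block_add (x y : L2 G H →L[ℂ] L2 G H) (g h : G) :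
    block (x + y) g h = block x g h + block y g h := by
  ext η
  simp [block_apply]

theorem block_smul (c : ℂ) (x : L2 G H →L[ℂ] L2 G H) (g h : G) :
    block (c • x) g h = c • block x g h := by
  ext η
  simp [block_apply]

theorem block_sum {ι : Type*} (s : Finset ι) (f : ι → (L2 G H →L[ℂ] L2 G H)) (g h : G) :
    block (∑ i ∈ s, f i) g h = ∑ i ∈ s, block (f i) g h := by
  ext η
  simp only [block_apply, sum_apply, lp.coeFn_sum, Finset.sum_apply]

theorem norm_block_le (x : L2 G H →L[ℂ] L2 G H) (g h : G) : ‖block x g h‖ ≤ ‖x‖ := by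
  classical
  refine ContinuousLinearMap.opNorm_le_bound _ (norm_nonneg x) fun η => ?_
  rw [block_apply]
  calc _ ≤ ‖x (lp.single 2 h η)‖ := lp.norm_apply_le_norm (by norm_num) _ g
    _ ≤ ‖x‖ * ‖lp.single (E := fun _ : G => H) 2 h η‖ := x.le_opNorm _
    _ = ‖x‖ * ‖η‖ := by rw [lp.norm_single (by norm_num)]

theorem continuous_block (g h : G) :
    Continuous fun x : L2 G H →L[ℂ] L2 G H => block x g h := by
  unfold block
  fun_prop

open Classical in
/-- A bounded operator is determined by its blocks. -/
theorem ext_block {x y : L2 G H →L[ℂ] L2 G H} (h : ∀ s t, block x s t = block y s t) :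
    x = y := by
  refine lp.ext_continuousLinearMap (by norm_num) fun t => ?_
  ext η s
  exact congrArg (fun T => T η) (h s t)

theorem block_one_smul (c : ℂ) (g h : G) [Decidable (g = h)] :
    block (c • (1 : L2 G H →L[ℂ] L2 G H)) g h = if g = h then c • 1 else 0 := by
  classical
  ext η
  rw [block_apply, smul_apply, one_apply_eq_self]
  split_ifs with hgh
  · subst hgh
    simp
  · simp [Pi.single_eq_of_ne hgh]

end Block

section BlockPsi

variable {H : Type u} [NormedAddCommGroup H] [InnerProductSpace ℂ H] [CompleteSpace H]
  {G : Type v} [Group G] (R : VonNeumannAlgebra H)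
  (α : G →* (R.toStarSubalgebra ≃⋆ₐ[ℂ] R.toStarSubalgebra))

open Classical in
theorem block_leftTranslation_mul_Psi (g : G) (r : R.toStarSubalgebra) (s t : G) :
    block (leftTranslation H g * Psi R α r) s t =
      if s = g * t then (α t⁻¹ r : H →L[ℂ] H) else 0 := by
  ext η
  rw [block_apply, mul_apply_eq_comp, leftTranslation_apply, Psi_apply, lp.single_apply]
  split_ifs with h
  · subst h
    simp
  · rw [Pi.single_eq_of_ne fun h' => h (by rw [← h']; group)]
    simp

theorem block_Psi_mul (r : R.toStarSubalgebra) (x : L2 G H →L[ℂ] L2 G H) (s t : G) :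
    block (Psi R α r * x) s t = (α s⁻¹ r : H →L[ℂ] H) * block x s t := rfl

theorem block_mul_Psi (r : R.toStarSubalgebra) (x : L2 G H →L[ℂ] L2 G H) (s t : G) :
    block (x * Psi R α r) s t = block x s t * (α t⁻¹ r : H →L[ℂ] H) := by
  classical
  ext η
  rw [block_apply, mul_apply_eq_comp, mul_apply_eq_comp, block_apply]
  refine congrArg (fun f => x f s) (lp.ext (funext fun p => ?_))
  rw [Psi_apply, lp.single_apply, lp.single_apply]
  by_cases h : p = t
  · subst h
    simp
  · simp [Pi.single_eq_of_ne h]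

end BlockPsi

/-! ### Partial sums of the series for `σ_ξ` -/

section PartialSigma

variable {H : Type u} [NormedAddCommGroup H] [InnerProductSpace ℂ H] [CompleteSpace H]
  {G : Type v} [Group G] (R : VonNeumannAlgebra H)
  (α : G →* (R.toStarSubalgebra ≃⋆ₐ[ℂ] R.toStarSubalgebra))
  (π : CondExpectation R) (ξ : L2 G ℂ)

theorem PosMatrix.map_Psi_condExpectation {n : Type*} [Fintype n] {M : n → n → (H →L[ℂ] H)}
    (hM : PosMatrix M) : PosMatrix fun i j => Psi R α (π.val (M i j)) :=
  PosMatrix.map_starHom R (psiHom R α) (M := fun i j => π.val (M i j)) (hM.map_cp π.toCP)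

theorem sigmaTerm_eq (x : L2 G H →L[ℂ] L2 G H) (p : G × G) :
    sigmaTerm R α π ξ x p = (star (ξ p.1) * ξ p.2) •
      (leftTranslation H p.1 * Psi R α (π.val (block x p.1 p.2)) * leftTranslation H p.2⁻¹) := by
  rw [sigmaTerm, leftTranslation_mul, mul_assoc, leftTranslation_mul_Psi, mul_assoc,
    ← StarAlgEquiv.mul_apply, ← map_mul, inv_mul_cancel, map_one]
  rfl

theorem inner_sigmaTerm (x : L2 G H →L[ℂ] L2 G H) (g h : G) (f f' : L2 G H) :
    inner ℂ f (sigmaTerm R α π ξ x (g, h) f') =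
      inner ℂ (ξ g • leftTranslation H g⁻¹ f)
        (Psi R α (π.val (block x g h)) (ξ h • leftTranslation H h⁻¹ f')) := by
  rw [sigmaTerm_eq, smul_apply, inner_smul_right, mul_apply_eq_comp, mul_apply_eq_comp,
    inner_leftTranslation, map_smul, inner_smul_left, inner_smul_right, mul_assoc]
  rfl

theorem CondExpectation.val_add (x y : H →L[ℂ] H) : π.val (x + y) = π.val x + π.val y :=
  Subtype.ext (map_add π.toCP x y)

theorem CondExpectation.val_smul (c : ℂ) (x : H →L[ℂ] H) : π.val (c • x) = c • π.val x :=
  Subtype.ext (map_smul π.toCP c x)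

theorem CondExpectation.val_coe (r : R.toStarSubalgebra) : π.val (r : H →L[ℂ] H) = r :=
  Subtype.ext (π.fix r r.2)

theorem CondExpectation.val_mul_mul (r r' : R.toStarSubalgebra) (x : H →L[ℂ] H) :
    π.val ((r : H →L[ℂ] H) * x * r') = r * π.val x * r' := by
  apply Subtype.ext
  change π.toCP _ = r * π.toCP x * r'
  rw [π.map_mul_right _ _ r'.2, π.map_mul_left _ _ r.2]

theorem sigmaTerm_add (x y : L2 G H →L[ℂ] L2 G H) (p : G × G) :
    sigmaTerm R α π ξ (x + y) p = sigmaTerm R α π ξ x p + sigmaTerm R α π ξ y p := by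
  simp only [sigmaTerm, block_add, CondExpectation.val_add, map_add, ← psiHom_apply,
    mul_add, smul_add]

theorem sigmaTerm_smul (c : ℂ) (x : L2 G H →L[ℂ] L2 G H) (p : G × G) :
    sigmaTerm R α π ξ (c • x) p = c • sigmaTerm R α π ξ x p := by
  simp only [sigmaTerm, block_smul, CondExpectation.val_smul, map_smul, ← psiHom_apply,
    mul_smul_comm]
  rw [smul_comm]

/-- The sum of the terms of the series for `σ_ξ(x)` with indices in the rectangle `A × B`. -/
def partialSigma (A B : Finset G) (x : L2 G H →L[ℂ] L2 G H) : L2 G H →L[ℂ] L2 G H :=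
  ∑ p ∈ A ×ˢ B, sigmaTerm R α π ξ x p

/-- Complete positivity of the partial sums, with the rectangle `A i × A j` allowed to depend on
the matrix entry: after the translations are moved to the vectors, the sum is the quadratic form
of the image under `Ψ ∘ π` of the matrix of the blocks of all `X i j`. -/
theorem sum_inner_partialSigma_nonneg {n : Type*} [Fintype n]
    {X : n → n → (L2 G H →L[ℂ] L2 G H)} (hX : PosMatrix X) (A : n → Finset G) (f : n → L2 G H) :
    0 ≤ ∑ i, ∑ j, inner ℂ (f i) (partialSigma R α π ξ (A i) (A j) (X i j) (f j)) := by
  classical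
  have hY : PosMatrix (n := Σ i, A i) fun p q => block (X p.1 q.1) (p.2 : G) (q.2 : G) := by
    intro v
    convert hX (fun i => ∑ g : A i, lp.single 2 (g : G) (v ⟨i, g⟩)) using 1
    rw [Fintype.sum_sigma]
    refine Fintype.sum_congr _ _ fun i => ?_
    simp only [Fintype.sum_sigma]
    rw [Finset.sum_comm]
    refine Fintype.sum_congr _ _ fun j => ?_
    rw [sum_inner]
    refine Fintype.sum_congr _ _ fun g => ?_
    rw [map_sum, inner_sum]
    refine Fintype.sum_congr _ _ fun h => ?_
    rw [block_apply, lp.inner_single_left]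
  have h := hY.map_Psi_condExpectation R α π
    (fun p => ξ (p.2 : G) • leftTranslation H (p.2 : G)⁻¹ (f p.1))
  convert h using 1
  rw [Fintype.sum_sigma]
  refine Fintype.sum_congr _ _ fun i => ?_
  simp only [Fintype.sum_sigma]
  rw [Finset.sum_comm]
  refine Fintype.sum_congr _ _ fun j => ?_
  rw [partialSigma, sum_apply, inner_sum, Finset.sum_product, ← Finset.sum_coe_sort]
  refine Fintype.sum_congr _ _ fun g => ?_
  rw [← Finset.sum_coe_sort]
  exact Fintype.sum_congr _ _ fun h => inner_sigmaTerm R α π ξ _ _ _ _ _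

theorem partialSigma_smul_one (A : Finset G) (c : ℂ) :
    partialSigma R α π ξ A A (c • 1) = ((∑ g ∈ A, ‖ξ g‖ ^ 2 : ℝ) * c) • 1 := by
  classical
  have hterm : ∀ g h : G, sigmaTerm R α π ξ (c • 1) (g, h) =
      if g = h then ((‖ξ g‖ ^ 2 : ℝ) * c : ℂ) • (1 : L2 G H →L[ℂ] L2 G H) else 0 := by
    intro g h
    rw [sigmaTerm_smul, sigmaTerm_eq]
    have hb := block_one_smul (H := H) 1 g h
    rw [one_smul, one_smul] at hb
    rw [hb]
    split_ifs with hgh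
    · subst hgh
      have h1 : π.val (1 : H →L[ℂ] H) = 1 := CondExpectation.val_coe R π 1
      rw [h1, ← psiHom_apply, map_one, mul_one, ← leftTranslation_mul, mul_inv_cancel,
        leftTranslation_one, smul_smul, mul_comm c]
      congr 2
      rw [RCLike.star_def, Complex.conj_mul']
      push_cast
      rfl
    · have h0 : π.val (0 : H →L[ℂ] H) = 0 := CondExpectation.val_coe R π 0
      rw [h0, ← psiHom_apply, map_zero]
      simp
  rw [partialSigma, Finset.sum_product]
  simp only [hterm]
  rw [Finset.sum_congr rfl fun g hg => by
    rw [Finset.sum_ite_eq A g fun _ => _, if_pos hg]]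
  rw [← Finset.sum_smul, Complex.ofReal_sum, Finset.sum_mul]

/-- The positive `2 × 2` matrix with diagonal entries `‖x‖` and off-diagonal entries `x`, `x*`
turns complete positivity of the partial sums into a norm estimate. -/
theorem norm_partialSigma_le (A B : Finset G) (x : L2 G H →L[ℂ] L2 G H) :
    ‖partialSigma R α π ξ A B x‖ ≤
      ‖x‖ * (√(∑ g ∈ A, ‖ξ g‖ ^ 2) * √(∑ h ∈ B, ‖ξ h‖ ^ 2)) := by
  have hX : PosMatrix (n := Fin 2) ![![(‖x‖ : ℂ) • 1, x], ![star x, (‖x‖ : ℂ) • 1]] := by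
    intro v
    have h1 : inner ℂ (v 1) (star x (v 0)) = star (inner ℂ (v 0) (x (v 1))) := by
      rw [ContinuousLinearMap.star_eq_adjoint, ContinuousLinearMap.adjoint_inner_right]
      exact (inner_conj_symm _ _).symm
    have h2 : ‖inner ℂ (v 0) (x (v 1))‖ ≤ ‖x‖ * (‖v 0‖ * ‖v 1‖) := by
      calc _ ≤ ‖v 0‖ * ‖x (v 1)‖ := norm_inner_le_norm _ _
        _ ≤ ‖v 0‖ * (‖x‖ * ‖v 1‖) := by gcongr; exact x.le_opNorm _
        _ = _ := by ring
    have h3 := (Complex.abs_re_le_norm (inner ℂ (v 0) (x (v 1)))).trans h2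
    have h4 := (abs_le.1 h3).1
    simp only [Fin.sum_univ_two, Matrix.cons_val_zero, Matrix.cons_val_one,
      smul_apply, one_apply_eq_self, inner_smul_right, h1,
      inner_self_eq_norm_sq_to_K]
    have h5 : 0 ≤ ‖x‖ * ‖v 0‖ ^ 2 + ‖x‖ * ‖v 1‖ ^ 2 + 2 * (inner ℂ (v 0) (x (v 1))).re := by
      nlinarith [mul_nonneg (norm_nonneg x) (sq_nonneg (‖v 0‖ - ‖v 1‖))]
    generalize inner ℂ (v 0) (x (v 1)) = z at h5
    convert Complex.zero_le_real.2 h5 using 1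
    apply Complex.ext
    · simp [← Complex.ofReal_pow]
      ring
    · simp [← Complex.ofReal_pow]
  refine ContinuousLinearMap.opNorm_le_bound _ (by positivity) fun f' => ?_
  set y := partialSigma R α π ξ A B x
  set f := y f' with hf
  have hdet := det_nonneg_of_form_nonneg
    (P := (((∑ g ∈ A, ‖ξ g‖ ^ 2) * ‖x‖ * ‖f‖ ^ 2 : ℝ) : ℂ))
    (Q := (((∑ g ∈ B, ‖ξ g‖ ^ 2) * ‖x‖ * ‖f'‖ ^ 2 : ℝ) : ℂ))
    (z := inner ℂ f (y f')) (z' := inner ℂ f' (partialSigma R α π ξ B A (star x) f)) ?_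
    (Complex.ofReal_im _) (Complex.ofReal_im _)
  · have h := hdet.2
    have hn : ‖inner ℂ f f‖ = ‖f‖ ^ 2 := by simp [inner_self_eq_norm_sq_to_K]
    rw [← hf, hn, Complex.ofReal_re, Complex.ofReal_re] at h
    have h' : ‖f‖ ^ 2 * ‖f‖ ^ 2 ≤ ‖f‖ ^ 2 *
        ((∑ g ∈ A, ‖ξ g‖ ^ 2) * (∑ g ∈ B, ‖ξ g‖ ^ 2) * ‖x‖ ^ 2 * ‖f'‖ ^ 2) := by
      linarith
    rcases (norm_nonneg f).eq_or_lt with h0 | h0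
    · rw [← h0]
      positivity
    · have h2 := le_of_mul_le_mul_left h' (by positivity)
      refine le_of_sq_le_sq ?_ (by positivity)
      rw [mul_pow, mul_pow, mul_pow, Real.sq_sqrt (by positivity), Real.sq_sqrt (by positivity)]
      linarith
  · intro a
    have h := sum_inner_partialSigma_nonneg R α π ξ hX ![A, B] ![a • f, f']
    simp only [Fin.sum_univ_two, Matrix.cons_val_zero, Matrix.cons_val_one,
      partialSigma_smul_one, smul_apply, one_apply_eq_self, inner_smul_right, inner_smul_left,
      map_smul, inner_self_eq_norm_sq_to_K] at h
    convert h using 1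
    simp only [Complex.ofReal_mul, Complex.ofReal_pow, RCLike.star_def, Complex.coe_algebraMap]
    ring

end PartialSigma

/-! ### The map `σ_ξ` -/

theorem hasSum_norm_sq {ι : Type v} {E : Type u} [NormedAddCommGroup E] (f : L2 ι E) :
    HasSum (fun i => ‖f i‖ ^ 2) (‖f‖ ^ 2) := by
  simpa using lp.hasSum_norm (by norm_num) f

theorem tendsto_finset_product_self {ι : Type*} :
    Tendsto (fun F : Finset ι => F ×ˢ F) atTop (atTop : Filter (Finset (ι × ι))) :=
  tendsto_finsetProd_atTop.comp tendsto_atTop_diagonal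

/-- The norm topology is finer than the ultraweak topology. -/
theorem topology_le_ultraweak (K : Type u) [NormedAddCommGroup K] [InnerProductSpace ℂ K] :
    (inferInstance : TopologicalSpace (K →L[ℂ] K)) ≤ ultraweakTopology K := by
  refine continuous_iff_le_induced.1 (continuous_pi fun ⟨p₁, p₂⟩ => ?_)
  have hs : Summable fun n => ‖p₂ n‖ * ‖p₁ n‖ := by
    refine Summable.of_nonneg_of_le (fun n => by positivity) (fun n => ?_)
      ((hasSum_norm_sq p₂).add (hasSum_norm_sq p₁)).summable
    nlinarith [sq_nonneg (‖p₂ n‖ - ‖p₁ n‖), sq_nonneg ‖p₂ n‖, sq_nonneg ‖p₁ n‖]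
  have hb : ∀ (x : K →L[ℂ] K) (n : ℕ), ‖inner ℂ (p₂ n) (x (p₁ n))‖ ≤ ‖x‖ * (‖p₂ n‖ * ‖p₁ n‖) := by
    intro x n
    calc _ ≤ ‖p₂ n‖ * ‖x (p₁ n)‖ := norm_inner_le_norm _ _
      _ ≤ ‖p₂ n‖ * (‖x‖ * ‖p₁ n‖) := by gcongr; exact x.le_opNorm _
      _ = _ := by ring
  have hsum : ∀ x : K →L[ℂ] K, Summable fun n => inner ℂ (p₂ n) (x (p₁ n)) := fun x =>
    Summable.of_norm_bounded (hs.mul_left ‖x‖) (hb x)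
  refine (LipschitzWith.of_dist_le_mul (K := (∑' n, ‖p₂ n‖ * ‖p₁ n‖).toNNReal)
    fun x y => ?_).continuous
  rw [Real.coe_toNNReal _ (tsum_nonneg fun n => by positivity), dist_eq_norm, dist_eq_norm,
    ← (hsum x).tsum_sub (hsum y), mul_comm]
  refine tsum_of_norm_bounded (hs.hasSum.mul_left _) fun n => ?_
  rw [← inner_sub_right, ← sub_apply]
  exact hb (x - y) n

section Sigma

variable {H : Type u} [NormedAddCommGroup H] [InnerProductSpace ℂ H] [CompleteSpace H]
  {G : Type v} [Group G] (R : VonNeumannAlgebra H)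
  (α : G →* (R.toStarSubalgebra ≃⋆ₐ[ℂ] R.toStarSubalgebra))
  (π : CondExpectation R) (ξ : L2 G ℂ)

theorem partialSigma_union_left [DecidableEq G] (A A' B : Finset G) (h : Disjoint A A')
    (x : L2 G H →L[ℂ] L2 G H) : partialSigma R α π ξ (A ∪ A') B x =
      partialSigma R α π ξ A B x + partialSigma R α π ξ A' B x := by
  rw [partialSigma, Finset.union_product, Finset.sum_union]
  · rfl
  · exact Finset.disjoint_product.2 (Or.inl h)

theorem partialSigma_union_right [DecidableEq G] (A B B' : Finset G) (h : Disjoint B B')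
    (x : L2 G H →L[ℂ] L2 G H) : partialSigma R α π ξ A (B ∪ B') x =
      partialSigma R α π ξ A B x + partialSigma R α π ξ A B' x := by
  rw [partialSigma, Finset.product_union, Finset.sum_union]
  · rfl
  · exact Finset.disjoint_product.2 (Or.inr h)

/-- The partial sums over squares `F × F` form a norm Cauchy net, since enlarging `F` adds two
rectangles with a side on which `ξ` is small. -/
theorem cauchySeq_partialSigma (x : L2 G H →L[ℂ] L2 G H) :
    CauchySeq fun F : Finset G => partialSigma R α π ξ F F x := by
  classical
  have hle : ∀ A : Finset G, √(∑ g ∈ A, ‖ξ g‖ ^ 2) ≤ ‖ξ‖ := fun A =>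
    Real.sqrt_le_iff.2 ⟨norm_nonneg _,
      sum_le_hasSum A (fun _ _ => by positivity) (hasSum_norm_sq ξ)⟩
  rw [Metric.cauchySeq_iff']
  intro ε hε
  set C := 2 * ‖x‖ * ‖ξ‖ + 1 with hC
  have hCpos : 0 < C := by positivity
  obtain ⟨F₀, hF₀⟩ := summable_iff_vanishing_norm.1 (hasSum_norm_sq ξ).summable
    ((ε / C) ^ 2) (by positivity)
  refine ⟨F₀, fun F hF => ?_⟩
  set D := F \ F₀
  have hd : Disjoint F₀ D := Finset.disjoint_sdiff
  have hU : F = F₀ ∪ D := (Finset.union_sdiff_of_subset hF).symm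
  have hD : √(∑ g ∈ D, ‖ξ g‖ ^ 2) < ε / C := by
    rw [Real.sqrt_lt' (by positivity)]
    exact (Real.le_norm_self _).trans_lt (hF₀ D hd.symm)
  have hsplit : partialSigma R α π ξ F F x - partialSigma R α π ξ F₀ F₀ x =
      partialSigma R α π ξ F₀ D x + partialSigma R α π ξ D F x := by
    nth_rewrite 1 [hU]
    rw [partialSigma_union_left R α π ξ F₀ D F hd]
    nth_rewrite 1 [hU]
    rw [partialSigma_union_right R α π ξ F₀ F₀ D hd]
    abel
  rw [dist_eq_norm, hsplit]
  have h1 := norm_partialSigma_le R α π ξ F₀ D x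
  have h2 := norm_partialSigma_le R α π ξ D F x
  calc _ ≤ ‖x‖ * (‖ξ‖ * (ε / C)) + ‖x‖ * (ε / C * ‖ξ‖) := by
        refine (norm_add_le _ _).trans (add_le_add (h1.trans ?_) (h2.trans ?_))
        · gcongr
          exact hle _
        · gcongr
          exact hle _
    _ = (2 * ‖x‖ * ‖ξ‖) * (ε / C) := by ring
    _ < C * (ε / C) := by gcongr; linarith
    _ = ε := by field_simp

/-- The operator `σ_ξ(x)`, as the norm limit of the partial sums over squares. -/
def sigma (x : L2 G H →L[ℂ] L2 G H) : L2 G H →L[ℂ] L2 G H :=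
  (cauchySeq_tendsto_of_complete (cauchySeq_partialSigma R α π ξ x)).choose

theorem tendsto_sigma (x : L2 G H →L[ℂ] L2 G H) :
    Tendsto (fun F : Finset G => partialSigma R α π ξ F F x) atTop (𝓝 (sigma R α π ξ x)) :=
  (cauchySeq_tendsto_of_complete (cauchySeq_partialSigma R α π ξ x)).choose_spec

theorem PosMatrix.sigma {n : Type*} [Fintype n] {X : n → n → (L2 G H →L[ℂ] L2 G H)}
    (hX : PosMatrix X) : PosMatrix fun i j => sigma R α π ξ (X i j) := by
  intro f
  refine ge_of_tendsto' (f := fun F : Finset G =>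
    ∑ i, ∑ j, inner ℂ (f i) (partialSigma R α π ξ F F (X i j) (f j))) (x := atTop) ?_
    fun F => sum_inner_partialSigma_nonneg R α π ξ hX (fun _ => F) f
  refine tendsto_finsetSum _ fun i _ => tendsto_finsetSum _ fun j _ => ?_
  have hc : Continuous fun y : L2 G H →L[ℂ] L2 G H => inner ℂ (f i) (y (f j)) := by fun_prop
  exact (hc.tendsto _).comp (tendsto_sigma R α π ξ (X i j))

/-- `σ_ξ` as a completely positive map. -/
def sigmaCP : (L2 G H →L[ℂ] L2 G H) →CP (L2 G H →L[ℂ] L2 G H) where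
  toFun := sigma R α π ξ
  map_add' x y := by
    refine tendsto_nhds_unique (tendsto_sigma R α π ξ (x + y)) ?_
    refine ((tendsto_sigma R α π ξ x).add (tendsto_sigma R α π ξ y)).congr fun F => ?_
    simp only [partialSigma, sigmaTerm_add, Finset.sum_add_distrib]
  map_smul' c x := by
    refine tendsto_nhds_unique (tendsto_sigma R α π ξ (c • x)) ?_
    refine ((tendsto_sigma R α π ξ x).const_smul c).congr fun F => ?_
    simp only [partialSigma, sigmaTerm_smul, Finset.smul_sum]
  map_cstarMatrix_nonneg' k M hM := by
    rw [cstarMatrix_nonneg_iff] at hM ⊢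
    exact hM.sigma R α π ξ

theorem norm_sigmaTerm_le (x : L2 G H →L[ℂ] L2 G H) (g h : G) :
    ‖sigmaTerm R α π ξ x (g, h)‖ ≤ ‖x‖ * (‖ξ g‖ * ‖ξ h‖) := by
  simpa [partialSigma] using norm_partialSigma_le R α π ξ {g} {h} x

theorem block_sigmaTerm_eq_zero (x : L2 G H →L[ℂ] L2 G H) (s t : G) (p : G × G)
    (hp : p ∉ Set.range fun q : G => (s * q, t * q)) :
    block (sigmaTerm R α π ξ x p) s t = 0 := by
  classical
  rw [sigmaTerm, block_smul, block_leftTranslation_mul_Psi, if_neg, smul_zero]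
  intro hs
  refine hp ⟨t⁻¹ * p.2, Prod.ext ?_ ?_⟩
  · rw [hs]
    group
  · group

/-- The `(s,t)`-block of a term vanishes unless the term has an index `(sq, tq)`, and the terms
with these indices are absolutely summable by the Cauchy–Schwarz inequality. -/
theorem summable_block_sigmaTerm (x : L2 G H →L[ℂ] L2 G H) (s t : G) :
    Summable fun p => block (sigmaTerm R α π ξ x p) s t := by
  have hinj : Function.Injective fun q : G => (s * q, t * q) := fun q q' h =>
    mul_left_cancel (congrArg Prod.fst h)
  rw [← hinj.summable_iff (block_sigmaTerm_eq_zero R α π ξ x s t)]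
  have hs : Summable fun q : G => ‖ξ (s * q)‖ ^ 2 :=
    (hasSum_norm_sq ξ).summable.comp_injective (mul_right_injective s)
  have ht : Summable fun q : G => ‖ξ (t * q)‖ ^ 2 :=
    (hasSum_norm_sq ξ).summable.comp_injective (mul_right_injective t)
  refine Summable.of_norm_bounded ((hs.add ht).mul_left ‖x‖) fun q => ?_
  refine (norm_block_le _ _ _).trans ((norm_sigmaTerm_le R α π ξ x _ _).trans ?_)
  gcongr
  nlinarith [sq_nonneg (‖ξ (s * q)‖ - ‖ξ (t * q)‖), sq_nonneg ‖ξ (s * q)‖, sq_nonneg ‖ξ (t * q)‖]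

theorem hasBlockSum_sigma (x : L2 G H →L[ℂ] L2 G H) :
    HasBlockSum (sigmaTerm R α π ξ x) (sigma R α π ξ x) := by
  intro s t
  have hsum := (summable_block_sigmaTerm R α π ξ x s t).hasSum
  have h1 := Tendsto.comp hsum tendsto_finset_product_self
  have h2 := ((continuous_block s t).tendsto _).comp (tendsto_sigma R α π ξ x)
  have h3 := tendsto_nhds_unique h2 (h1.congr fun F => (block_sum _ _ _ _).symm)
  rwa [h3]

theorem hasBlockSum_iff (x y : L2 G H →L[ℂ] L2 G H) :
    HasBlockSum (sigmaTerm R α π ξ x) y ↔ y = sigma R α π ξ x := by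
  constructor
  · exact fun h => ext_block fun s t => (h s t).unique (hasBlockSum_sigma R α π ξ x s t)
  · rintro rfl
    exact hasBlockSum_sigma R α π ξ x

theorem sigma_mem_crossedProduct (x : L2 G H →L[ℂ] L2 G H) :
    sigma R α π ξ x ∈ crossedProduct R α := by
  refine closure.mono (topology_le_ultraweak (L2 G H))
    (mem_closure_of_tendsto (tendsto_sigma R α π ξ x) (Eventually.of_forall fun F => ?_))
  exact Submodule.sum_mem _ fun p _ => Submodule.smul_mem _ _ (Submodule.subset_span ⟨_, _, rfl⟩)

theorem sigmaTerm_Psi_mul_mul_Psi (r r' : R.toStarSubalgebra) (x : L2 G H →L[ℂ] L2 G H)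
    (p : G × G) : sigmaTerm R α π ξ (Psi R α r * x * Psi R α r') p =
      Psi R α r * sigmaTerm R α π ξ x p * Psi R α r' := by
  have h1 : Psi R α r * leftTranslation H p.1 =
      leftTranslation H p.1 * Psi R α (α p.1⁻¹ r) := by
    rw [leftTranslation_mul_Psi, ← StarAlgEquiv.mul_apply, ← map_mul, mul_inv_cancel, map_one]
    rfl
  have h2 := leftTranslation_mul_Psi R α p.2⁻¹ r'
  rw [sigmaTerm_eq, sigmaTerm_eq, block_mul_Psi, block_Psi_mul, CondExpectation.val_mul_mul, mul_smul_comm,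
    smul_mul_assoc]
  simp only [← psiHom_apply, map_mul] at h1 h2 ⊢
  simp only [mul_assoc]
  rw [h2, ← mul_assoc (psiHom R α r), h1]
  simp only [mul_assoc]

theorem sigma_Psi_mul_mul_Psi (r r' : R.toStarSubalgebra) (x : L2 G H →L[ℂ] L2 G H) :
    sigma R α π ξ (Psi R α r * x * Psi R α r') = Psi R α r * sigma R α π ξ x * Psi R α r' := by
  refine tendsto_nhds_unique (tendsto_sigma R α π ξ _) ?_
  refine (((tendsto_sigma R α π ξ x).const_mul (Psi R α r)).mul_const (Psi R α r')).congr
    fun F => ?_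
  simp only [partialSigma, sigmaTerm_Psi_mul_mul_Psi, Finset.mul_sum, Finset.sum_mul]

/-- Only the indices `(gq, q)` contribute to `σ_ξ(L_g Ψ(r))`, and each of these terms is a scalar
multiple of `L_g Ψ(r)`. -/
theorem sigmaTerm_leftTranslation_mul_Psi [DecidableEq G] (g : G) (r : R.toStarSubalgebra)
    (p : G × G) : sigmaTerm R α π ξ (leftTranslation H g * Psi R α r) p =
      if p.1 = g * p.2 then
        (star (ξ p.1) * ξ p.2) • (leftTranslation H g * Psi R α r) else 0 := by
  rw [sigmaTerm, block_leftTranslation_mul_Psi]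
  split_ifs with h
  · rw [CondExpectation.val_coe, h, mul_inv_cancel_right, ← StarAlgEquiv.mul_apply, ← map_mul, mul_inv_cancel,
      map_one]
    rfl
  · have h0 : π.val (0 : H →L[ℂ] H) = 0 := CondExpectation.val_coe R π 0
    rw [h0, ← psiHom_apply, map_zero, map_zero]
    simp

theorem sigma_leftTranslation_mul_Psi (g : G) (r : R.toStarSubalgebra) :
    sigma R α π ξ (leftTranslation H g * Psi R α r) =
      (inner ℂ ξ (leftTranslation ℂ g ξ) : ℂ) • (leftTranslation H g * Psi R α r) := by
  classical
  symm
  rw [← hasBlockSum_iff]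
  intro s t
  have hinj : Function.Injective fun q : G => (g * q, q) := fun q q' h => congrArg Prod.snd h
  rw [← hinj.hasSum_iff]
  · have h := lp.hasSum_inner (𝕜 := ℂ) ξ (leftTranslation ℂ g ξ)
    rw [← (Equiv.mulLeft g).hasSum_iff] at h
    have h2 := h.smul_const (block (leftTranslation H g * Psi R α r) s t)
    rw [block_smul]
    convert h2 using 2 with q
    simp only [Function.comp_apply, sigmaTerm_leftTranslation_mul_Psi, if_true, block_smul,
      Equiv.coe_mulLeft, leftTranslation_apply, inv_mul_cancel_left]
    congr 1
    simp [mul_comm]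
  · intro p hp
    rw [sigmaTerm_leftTranslation_mul_Psi, if_neg, ← zero_smul ℂ (1 : L2 G H →L[ℂ] L2 G H),
      block_smul, zero_smul]
    exact fun h => hp ⟨p.2, Prod.ext h.symm rfl⟩

theorem sigma_one (hξ : ‖ξ‖ = 1) : sigma R α π ξ 1 = 1 := by
  have h := sigma_leftTranslation_mul_Psi R α π ξ 1 1
  rw [leftTranslation_one, leftTranslation_one, ← psiHom_apply, map_one, mul_one,
    one_apply_eq_self, inner_self_eq_norm_sq_to_K, hξ] at h
  simpa using h

end Sigma

/-! ### Existence of a conditional expectation -/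

section Existence

variable {H : Type u} [NormedAddCommGroup H] [InnerProductSpace ℂ H] [CompleteSpace H]

/-- Injectivity, applied to the inclusion of `R` into `B(H)` and the identity of `R`. -/
theorem IsInjective.nonempty_condExpectation {R : VonNeumannAlgebra H} (hR : IsInjective R) :
    Nonempty (CondExpectation R) := by
  let _ : CStarAlgebra R.toStarSubalgebra :=
    StarSubalgebra.cstarAlgebra _ (h_closed := isClosed_vonNeumann R)
  let _ : PartialOrder R.toStarSubalgebra := CStarAlgebra.spectralOrder _
  have _ : StarOrderedRing R.toStarSubalgebra := CStarAlgebra.spectralOrderedRing _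
  let inc : R.toStarSubalgebra →⋆ₐ[ℂ] (H →L[ℂ] H) := R.toStarSubalgebra.subtype
  obtain ⟨ψ, hψ, hfix⟩ := hR R.toStarSubalgebra (H →L[ℂ] H) inc Subtype.coe_injective
    (CompletelyPositiveMapClass.toCompletelyPositiveLinearMap inc) fun a => a.2
  exact ⟨⟨ψ, hψ, fun r hr => hfix ⟨r, hr⟩⟩⟩

end Existence

end CrossedExp

end

theorem mainTheorem2 {H : Type*} [NormedAddCommGroup H] [InnerProductSpace ℂ H]
    [CompleteSpace H] {G : Type*} [Group G] (R : VonNeumannAlgebra H)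
    (hR : CrossedExp.IsInjective R)
    (α : G →* (R.toStarSubalgebra ≃⋆ₐ[ℂ] R.toStarSubalgebra)) :
    Nonempty (CrossedExp.CondExpectation R) ∧
    ∀ (π : CrossedExp.CondExpectation R) (ξ : CrossedExp.L2 G ℂ), ‖ξ‖ = 1 →
      ∃ σ : (CrossedExp.L2 G H →L[ℂ] CrossedExp.L2 G H) →CP
          (CrossedExp.L2 G H →L[ℂ] CrossedExp.L2 G H),
        (∀ x y, CrossedExp.HasBlockSum (CrossedExp.sigmaTerm R α π ξ x) y ↔ y = σ x) ∧
        (∀ x, σ x ∈ CrossedExp.crossedProduct R α) ∧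
        σ 1 = 1 ∧
        (∀ (r r' : R.toStarSubalgebra) (x : CrossedExp.L2 G H →L[ℂ] CrossedExp.L2 G H),
          σ (CrossedExp.Psi R α r * x * CrossedExp.Psi R α r') =
            CrossedExp.Psi R α r * σ x * CrossedExp.Psi R α r') ∧
        (∀ (g : G) (r : R.toStarSubalgebra),
          σ (CrossedExp.leftTranslation H g * CrossedExp.Psi R α r) =
            (inner ℂ ξ (CrossedExp.leftTranslation ℂ g ξ) : ℂ) •
              (CrossedExp.leftTranslation H g * CrossedExp.Psi R α r)) :=
  ⟨hR.nonempty_condExpectation, fun π ξ hξ =>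
    ⟨CrossedExp.sigmaCP R α π ξ, CrossedExp.hasBlockSum_iff R α π ξ,
      CrossedExp.sigma_mem_crossedProduct R α π ξ, CrossedExp.sigma_one R α π ξ hξ,
      CrossedExp.sigma_Psi_mul_mul_Psi R α π ξ,
      CrossedExp.sigma_leftTranslation_mul_Psi R α π ξ⟩⟩
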